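/- Let $V$ be a complex Hilbert space, let $q\in\mathbb R$, and let $\mathcal H=\ell_2\otimes V$, where $(e_j)_{j\ge 0}$ is the canonical basis of $\ell_2$ and $P_j$ is the projection onto $\mathbb C e_j$. Inner products are linear in the second variable. Let $\mathcal D\subseteq V$ be a dense subspace ($\mathcal D=V$ in the bounded case) and let $\mathcal H_{\mathcal D}\subseteq\mathcal H$ be the subspace of all vectors whose components $x_j\in V$ in $\mathcal H=\bigoplus_j e_j\otimes V$ lie in $\mathcal D$. On the algebraic Fock space $\mathbb C\Omega\oplus\bigoplus_{m\ge1}\mathcal H_{\mathcal D}^{\otimes m}$, with $q$-inner product $\langle\xi,\eta\rangle_q=\delta_{m,n}\langle\xi,P^q_n\eta\rangle$ for elementary tensors of lengths $m$ and $n$, where $P^q_n(\eta_1\otimes\cdots\otimes\eta_n)=\sum_{\sigma\in\mathfrak S_n}q^{|\sigma|}\,\eta_{\sigma^{-1}(1)}\otimes\cdots\otimes\eta_{\sigma^{-1}(n)}$ and $|\sigma|$ is the number of inversions (for $|q|\le1$ this is a dense domain in $q$-Fock space over $\mathcal H$, modulo null vectors if $|q|=1$), define for $\xi\in\mathcal H_{\mathcal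 D}$ and linear $S:\mathcal H_{\mathcal D}\to\mathcal H_{\mathcal D}$ $$L(\xi)\,\eta_1\otimes\cdots\otimes\eta_m=\xi\otimes\eta_1\otimes\cdots\otimes\eta_m,\qquad L^*(\xi)\,\eta_1\otimes\cdots\otimes\eta_m=\sum_{k=1}^m q^{k-1}\langle\xi,\eta_k\rangle\,\eta_1\otimes\cdots\hat\eta_k\cdots\otimes\eta_m,$$ $$\gamma(S)\,\eta_1\otimes\cdots\otimes\eta_m=\sum_{k=1}^m q^{k-1}\,S\eta_k\otimes\eta_1\otimes\cdots\hat\eta_k\cdots\otimes\eta_m,$$ with $L(\xi)\Omega=\xi$ and $L^*(\xi)\Omega=\gamma(S)\Omega=0$. Let $\rho(X)=\langle\Omega,X\Omega\rangle_q$, and for $v\in\mathcal D$ and linear $T:\mathcal D\to\mathcal D$ put $L_j(v)=L(e_j\otimes v)$, $L_j^*(v)=L^*(e_j\otimes v)$, $\gamma_j(T)=\gamma(P_j\otimes T)$. Let $n\ge0$, and for $1\le i\le n$ let $v_i\in\mathcal D$, $\lambda_i\in\mathbb C$ and let $T_i:\mathcal D\to\mathcal D$ be linear. Set $$X_i^{(k)}=L_k^*(v_i)+L_k(v_i)+\gamma_k(T_i)+\lambda_i\quad(k\ge0),\qquad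 X_i=X_i^{(0)}.$$ For a partition $\sigma$ of $\{1,\dots,n\}$ let $\rho_\sigma(X_1,\dots,X_n)=\rho(X_1^{(\sigma(1))}\cdots X_n^{(\sigma(n))})$, where $\sigma(i)$ is a label of the block of $\sigma$ that contains $i$ (distinct blocks have distinct labels; take the smallest element of the block, say). Define the partitioned cumulants by $$K^q_\pi(X_1,\dots,X_n)=\sum_{\sigma\le\pi}\rho_\sigma(X_1,\dots,X_n)\,\mu(\sigma,\pi),$$ where $\mu$ is the Möbius function of the lattice of set partitions ordered by refinement, and let $K^q_n=K^q_{\hat 1_n}$ be the cumulant for the one-block partition. Then for every partition $\pi$ of $\{1,\dots,n\}$ $$K^q_\pi(X_1,\dots,X_n)=q^{rc(\pi)}\prod_{B\in\pi}K^q_{|B|}(X_B).$$ Here $X_B=(X_{i_1},\dots,X_{i_b})$ for a block $B=\{i_1<\dots<i_b\}$, and $rc(\pi)$ is the number of reduced crossings of $\pi$, i.e. the number of quadruples $i<i'<j<j'$ such that $i,j$ are consecutive elements of one block of $\pi$ and $i',j'$ are consecutive elements of another block. -/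

import Mathlib

open scoped TensorProduct DirectSum

noncomputable section

namespace QFock

/-! ### Algebraic `q`-Fock space over a complex pre-Hilbert space -/

section Fock

variable (E : Type*) [NormedAddCommGroup E] [InnerProductSpace ℂ E]

/-- The `n`-particle space `E^{⊗ n}`. -/
abbrev Particles (n : ℕ) : Type _ := ⨂[ℂ] _ : Fin n, E

/-- The algebraic Fock space `ℂΩ ⊕ E ⊕ E^{⊗ 2} ⊕ ⋯`. Equipped with the `q`-inner product below,
it is the dense domain in `q`-Fock space on which all the operators are defined. -/
abbrev AlgFock : Type _ := ⨁ n : ℕ, Particles E n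

variable {E}

/-- The elementary tensor `η₁ ⊗ ⋯ ⊗ ηₙ` as a vector of the Fock space. -/
def elem {n : ℕ} (η : Fin n → E) : AlgFock E :=
  DirectSum.lof ℂ ℕ (Particles E) n (PiTensorProduct.tprod ℂ η)

variable (E) in
/-- The vacuum vector `Ω`, i.e. the empty elementary tensor. -/
def vacuum : AlgFock E := elem (Fin.elim0 : Fin 0 → E)

/-- The number of inversions of a permutation. -/
def inversions {n : ℕ} (σ : Equiv.Perm (Fin n)) : ℕ :=
  (Finset.univ.filter fun p : Fin n × Fin n => p.1 < p.2 ∧ σ p.2 < σ p.1).card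

variable (E) in
/-- The `q`-symmetrizator `P_n^q = ∑_σ q^{|σ|} U_n(σ)` on the `n`-particle space, where
`U_n(σ) η₁ ⊗ ⋯ ⊗ ηₙ = η_{σ⁻¹(1)} ⊗ ⋯ ⊗ η_{σ⁻¹(n)}`. -/
def qSymm (q : ℝ) (n : ℕ) : Particles E n →ₗ[ℂ] Particles E n :=
  ∑ σ : Equiv.Perm (Fin n),
    ((q : ℂ) ^ inversions σ) • (PiTensorProduct.reindex ℂ (fun _ : Fin n => E) σ).toLinearMap

/-- The functional `η ↦ ⟨ξ₁ ⊗ ⋯ ⊗ ξₙ, η⟩` on the `n`-particle space, for the undeformed inner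
product (linear in the second variable). -/
def innerElem {n : ℕ} (ξ : Fin n → E) : Particles E n →ₗ[ℂ] ℂ :=
  PiTensorProduct.lift
    ((MultilinearMap.mkPiAlgebra ℂ (Fin n) ℂ).compLinearMap fun i => innerₛₗ ℂ (ξ i))

/-- The `q`-inner product `η ↦ ⟨ξ₁ ⊗ ⋯ ⊗ ξ_m, η⟩_q = δ_{m,n} ⟨ξ₁ ⊗ ⋯ ⊗ ξ_m, P_n^q η⟩` of an
elementary tensor with the vectors of the Fock space. -/
def qInner (q : ℝ) {m : ℕ} (ξ : Fin m → E) : AlgFock E →ₗ[ℂ] ℂ :=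
  (innerElem ξ ∘ₗ qSymm E q m) ∘ₗ DirectSum.component ℂ ℕ (Particles E) m

/-- The vacuum expectation `ρ(X) = ⟨Ω, X Ω⟩_q`. -/
def vacuumState (q : ℝ) (X : Module.End ℂ (AlgFock E)) : ℂ :=
  qInner q (Fin.elim0 : Fin 0 → E) (X (vacuum E))

/-- The creation operator `L(ξ)`. -/
def creation (ξ : E) : Module.End ℂ (AlgFock E) :=
  DirectSum.toModule ℂ ℕ (AlgFock E) fun n =>
    DirectSum.lof ℂ ℕ (Particles E) (n + 1) ∘ₗ
      PiTensorProduct.lift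
        ((PiTensorProduct.tprod ℂ : MultilinearMap ℂ (fun _ : Fin (n + 1) => E) _).curryLeft ξ)

/-- The annihilation operator `L*(ξ)`. -/
def annihilation (q : ℝ) (ξ : E) : Module.End ℂ (AlgFock E) :=
  DirectSum.toModule ℂ ℕ (AlgFock E) fun
    | 0 => 0
    | n + 1 =>
      DirectSum.lof ℂ ℕ (Particles E) n ∘ₗ
        PiTensorProduct.lift (∑ k : Fin (n + 1), ((q : ℂ) ^ (k : ℕ)) •
          LinearMap.uncurryMid (M := fun _ : Fin (n + 1) => E) k
            ((innerₛₗ ℂ ξ).smulRight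
              (PiTensorProduct.tprod ℂ : MultilinearMap ℂ (fun _ : Fin n => E) (Particles E n))))

/-- The gauge operator `γ(T)`, for `T` mapping the one-particle domain `E` to itself. -/
def gauge (q : ℝ) (T : E →ₗ[ℂ] E) : Module.End ℂ (AlgFock E) :=
  DirectSum.toModule ℂ ℕ (AlgFock E) fun
    | 0 => 0
    | n + 1 =>
      DirectSum.lof ℂ ℕ (Particles E) (n + 1) ∘ₗ
        PiTensorProduct.lift (∑ k : Fin (n + 1), ((q : ℂ) ^ (k : ℕ)) •
          LinearMap.uncurryMid (M := fun _ : Fin (n + 1) => E) k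
            ((PiTensorProduct.tprod ℂ :
              MultilinearMap ℂ (fun _ : Fin (n + 1) => E) (Particles E (n + 1))).curryLeft ∘ₗ T))

/-- `L(ξ) η₁ ⊗ ⋯ ⊗ ηₙ = ξ ⊗ η₁ ⊗ ⋯ ⊗ ηₙ` (for `n = 0`: `L(ξ) Ω = ξ`). -/
theorem creation_elem (ξ : E) {n : ℕ} (η : Fin n → E) :
    creation ξ (elem η) = elem (Fin.cons ξ η : Fin (n + 1) → E) := by
  simp [creation, elem, DirectSum.toModule_lof]

theorem annihilation_vacuum (q : ℝ) (ξ : E) : annihilation q ξ (vacuum E) = 0 := by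
  simp [annihilation, vacuum, elem, DirectSum.toModule_lof]

/-- `L*(ξ) η₁ ⊗ ⋯ ⊗ ηₙ = ∑ q^{k-1} ⟨ξ, η_k⟩ η₁ ⊗ ⋯ η̂_k ⋯ ⊗ ηₙ`
(the index `k` of `Fin` starts at `0`). -/
theorem annihilation_elem (q : ℝ) (ξ : E) {n : ℕ} (η : Fin (n + 1) → E) :
    annihilation q ξ (elem η) =
      ∑ k : Fin (n + 1), ((q : ℂ) ^ (k : ℕ) * inner ℂ ξ (η k)) • elem (k.removeNth η) := by
  simp [annihilation, elem, DirectSum.toModule_lof, smul_smul]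

theorem gauge_vacuum (q : ℝ) (T : E →ₗ[ℂ] E) : gauge q T (vacuum E) = 0 := by
  simp [gauge, vacuum, elem, DirectSum.toModule_lof]

/-- `γ(T) η₁ ⊗ ⋯ ⊗ ηₙ = ∑ q^{k-1} T η_k ⊗ η₁ ⊗ ⋯ η̂_k ⋯ ⊗ ηₙ`. -/
theorem gauge_elem (q : ℝ) (T : E →ₗ[ℂ] E) {n : ℕ} (η : Fin (n + 1) → E) :
    gauge q T (elem η) =
      ∑ k : Fin (n + 1), ((q : ℂ) ^ (k : ℕ)) •
        elem (Fin.cons (T (η k)) (k.removeNth η) : Fin (n + 1) → E) := by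
  simp [gauge, elem, DirectSum.toModule_lof]

/-- `⟨ξ, η⟩_q = ∑_σ q^{|σ|} ∏ ⟨ξ_i, η_{σ⁻¹(i)}⟩` for elementary tensors of the same length. -/
theorem qInner_elem (q : ℝ) {n : ℕ} (ξ η : Fin n → E) :
    qInner q ξ (elem η) =
      ∑ σ : Equiv.Perm (Fin n), (q : ℂ) ^ inversions σ * ∏ i, inner ℂ (ξ i) (η (σ⁻¹ i)) := by
  simp [qInner, elem, qSymm, innerElem, DirectSum.component.lof_self]

end Fock

/-! ### The space `ℓ₂ ⊗ V` and the exchangeable copies -/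

section Copies

variable {V : Type*} [NormedAddCommGroup V] [InnerProductSpace ℂ V]

/-- The Hilbert space `ℓ₂ ⊗ V`, realised as the space of square summable sequences in `V`
(the orthogonal direct sum of countably many copies of `V`). -/
abbrev EllTwo (V : Type*) [NormedAddCommGroup V] : Type _ := lp (fun _ : ℕ => V) 2

/-- The vectors of `ℓ₂ ⊗ V` all of whose components lie in the subspace `D` of `V`.
If `D` is all of `V`, this is all of `ℓ₂ ⊗ V`. -/
def oneParticleDomain (D : Submodule ℂ V) : Submodule ℂ (EllTwo V) where
  carrier := {x | ∀ j, x j ∈ D}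
  add_mem' hx hy j := D.add_mem (hx j) (hy j)
  zero_mem' _ := D.zero_mem
  smul_mem' c _ hx j := D.smul_mem c (hx j)

theorem single_mem_oneParticleDomain (D : Submodule ℂ V) (j : ℕ) (v : D) :
    lp.single 2 j (v : V) ∈ oneParticleDomain D := by
  intro k
  rw [lp.single_apply]
  by_cases h : k = j
  · subst h; simp
  · simp [Pi.single_eq_of_ne h]

/-- The vector `e_j ⊗ v`. -/
def basisTensor {D : Submodule ℂ V} (j : ℕ) (v : D) : oneParticleDomain D :=
  ⟨lp.single 2 j (v : V), single_mem_oneParticleDomain D j v⟩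

theorem basisTensor_add {D : Submodule ℂ V} (j : ℕ) (v w : D) :
    basisTensor j (v + w) = basisTensor j v + basisTensor j w :=
  Subtype.ext (lp.single_add (E := fun _ : ℕ => V) 2 j (v : V) (w : V))

theorem basisTensor_smul {D : Submodule ℂ V} (j : ℕ) (c : ℂ) (v : D) :
    basisTensor j (c • v) = c • basisTensor j v :=
  Subtype.ext (lp.single_smul (E := fun _ : ℕ => V) 2 j c (v : V))

/-- The operator `P_j ⊗ T`, where `P_j` is the orthogonal projection of `ℓ₂` onto `ℂ e_j`. -/
def projTensor {D : Submodule ℂ V} (j : ℕ) (T : D →ₗ[ℂ] D) :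
    oneParticleDomain D →ₗ[ℂ] oneParticleDomain D where
  toFun x := basisTensor j (T ⟨x.1 j, x.2 j⟩)
  map_add' x y := by
    rw [← basisTensor_add, ← map_add]; rfl
  map_smul' c x := by
    rw [RingHom.id_apply, ← basisTensor_smul, ← map_smul]; rfl

/-- The operator `γ_j(v, T, λ) = L_j*(v) + L_j(v) + γ_j(T) + λ`, where
`L_j(v) = L(e_j ⊗ v)` and `γ_j(T) = γ(P_j ⊗ T)`. For `j = 0` this is the random variable
`X = L_0*(v) + L_0(v) + γ_0(T) + λ`; for general `j` it is its `j`-th exchangeable copy. -/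
def gaugeProcess (q : ℝ) {D : Submodule ℂ V} (j : ℕ) (v : D) (T : D →ₗ[ℂ] D) (lam : ℂ) :
    Module.End ℂ (AlgFock (oneParticleDomain D)) :=
  annihilation q (basisTensor j v) + creation (basisTensor j v) + gauge q (projTensor j T)
    + lam • (1 : Module.End ℂ (AlgFock (oneParticleDomain D)))

end Copies

/-! ### Set partitions, partitioned moments and cumulants -/

section Cumulants

/-- Set partitions of an `n`-element set, ordered by refinement. -/
abbrev SetPartition (n : ℕ) : Type := Finpartition (Finset.univ : Finset (Fin n))

variable {n : ℕ}

/-- A partition as an index function: every element is sent to the label of its block,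
for which we take the smallest element of the block. -/
def label (π : SetPartition n) (i : Fin n) : ℕ :=
  (π.part i).min' ⟨i, π.mem_part (Finset.mem_univ i)⟩

/-- The kernel of the index function `label π` is `π`. -/
theorem label_eq_iff (π : SetPartition n) (i j : Fin n) :
    label π i = label π j ↔ π.part i = π.part j := by
  constructor
  · intro h
    have h' := Fin.val_injective h
    have hi := (π.part i).min'_mem ⟨i, π.mem_part (Finset.mem_univ i)⟩
    have hj := (π.part j).min'_mem ⟨j, π.mem_part (Finset.mem_univ j)⟩
    rw [h'] at hi
    exact π.eq_of_mem_parts (π.part_mem.2 (Finset.mem_univ i)) (π.part_mem.2 (Finset.mem_univ j))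
      hi hj
  · intro h
    simp only [label, h]

/-- The partitioned moment `φ_σ(X₁, …, Xₙ) = φ(X₁^{(σ(1))} ⋯ Xₙ^{(σ(n))})`, where `X i k` is the
`k`-th exchangeable copy of `X_i`. -/
def partMoment {A : Type*} [Monoid A] (φ : A → ℂ) (X : Fin n → ℕ → A) (σ : SetPartition n) : ℂ :=
  φ (List.ofFn fun i => X i (label σ i)).prod

open Classical in
/-- The Möbius function of the lattice of set partitions. -/
def moebius (σ π : SetPartition n) : ℂ :=
  letI : LocallyFiniteOrder (SetPartition n) := Fintype.toLocallyFiniteOrder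
  IncidenceAlgebra.mu ℂ σ π

open Classical in
/-- The partitioned cumulant `K_π(X₁, …, Xₙ) = ∑_{σ ≤ π} φ_σ(X₁, …, Xₙ) μ(σ, π)`. -/
def partCumulant {A : Type*} [Monoid A] (φ : A → ℂ) (X : Fin n → ℕ → A) (π : SetPartition n) :
    ℂ :=
  ∑ σ ∈ Finset.univ.filter (fun σ : SetPartition n => σ ≤ π), partMoment φ X σ * moebius σ π

/-- The cumulant `K_n`, which belongs to the partition with at most one block. -/
def cumulant {A : Type*} [Monoid A] (φ : A → ℂ) (X : Fin n → ℕ → A) : ℂ :=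
  partCumulant φ X ⊤

/-- `i < j` are consecutive elements of the same block of `π`. -/
def IsArc (π : SetPartition n) (i j : Fin n) : Prop :=
  i < j ∧ π.part i = π.part j ∧ ∀ k, i < k → k < j → π.part k ≠ π.part i

open Classical in
/-- The number `rc(π)` of reduced crossings: the number of quadruples `i < i' < j < j'` such that
`i, j` are consecutive elements of a block and `i', j'` are consecutive elements of another block. -/
def reducedCrossings (π : SetPartition n) : ℕ :=
  (Finset.univ.filter fun p : (Fin n × Fin n) × (Fin n × Fin n) =>
    IsArc π p.1.1 p.1.2 ∧ IsArc π p.2.1 p.2.2 ∧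
      p.1.1 < p.2.1 ∧ p.2.1 < p.1.2 ∧ p.1.2 < p.2.2).card

end Cumulants

end QFock

end

noncomputable section

namespace QFock

/-! ### Operators on elementary tensors indexed by lists -/

section ListTensor

variable {E : Type*} [NormedAddCommGroup E] [InnerProductSpace ℂ E]

/-! The core is an explicit expansion of `X_1 ⋯ X_n Ω`, built from the right. Each operator places
its index `a`, smaller than all indices already present, in a partition whose blocks are closed or
open (marked). The scalar makes `{a}` a closed singleton, creation opens `{a}`, gauge prepends `a`
to an open block and keeps it open, and annihilation prepends `a` to an open block and closes it. An
open block carries the vector obtained by applying its operators in order to its last vector; a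
closed block contributes a scalar, its `blockWeight`. The tensor lists the open blocks by increasing
first element (`fieldOperator_markedTerm`).

Reaching the open block with head `x` costs one factor `q` per open block with head `t < x`. The
step creates the arc `(a, x)`. If the block of `t` is closed or extended later, `t` becomes the
right end of an arc `(s, t)` with `s < a < t < x`, a reduced crossing. Thus an open head under an
arc is a crossing paid in advance, which is what `markedCrossings` counts. The vacuum keeps only the
terms without open blocks, so a moment is a sum over partitions of `q^rc` times the product of the
block weights.

With the copies coloured by `σ`, orthogonality of the `e_j` annihilates the weight of every block
that is not monochromatic and leaves the other weights unchanged. Hence `ρ_σ` is the sum of the same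
quantity, `cumulantValue`, over all `π ≤ σ` (`partMoment_gaugeProcess`). Möbius inversion identifies
`K_π` with `cumulantValue`; for one block there are no crossings, so the block weight is itself the
cumulant. The argument is algebraic: no positivity of the `q`-inner product enters. -/

theorem elem_congr {m n : ℕ} (h : m = n) {η : Fin m → E} {η' : Fin n → E}
    (hη : ∀ i : Fin m, η i = η' (Fin.cast h i)) : elem η = elem η' := by
  subst h
  exact congrArg elem (funext hη)

/-- The elementary tensor of the entries of a list. -/
def elemList (l : List E) : AlgFock E := elem l.get

theorem elemList_nil : elemList ([] : List E) = vacuum E :=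
  elem_congr rfl fun i => i.elim0

theorem creation_elemList (ξ : E) (l : List E) :
    creation ξ (elemList l) = elemList (ξ :: l) := by
  rw [elemList, creation_elem, elemList]
  refine elem_congr rfl fun i => ?_
  refine Fin.cases ?_ (fun j => ?_) i <;> simp

theorem elem_removeNth_get {n : ℕ} (l : List E) (h : l.length = n + 1) (k : Fin (n + 1)) :
    elem (k.removeNth fun i => l.get (Fin.cast h.symm i)) = elemList (l.eraseIdx k) := by
  have hk : (k : ℕ) < l.length := by omega
  refine elem_congr (by rw [List.length_eraseIdx_of_lt hk]; omega) fun i => ?_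
  simp only [Fin.removeNth_apply, List.get_eq_getElem, Fin.val_cast, List.getElem_eraseIdx]
  by_cases hik : (i : ℕ) < k
  · simp [hik, Fin.succAbove, Fin.lt_def]
  · simp [hik, Fin.succAbove, Fin.lt_def]

theorem annihilation_elemList (q : ℝ) (ξ : E) (l : List E) :
    annihilation q ξ (elemList l) =
      ∑ k : Fin l.length, ((q : ℂ) ^ (k : ℕ) * inner ℂ ξ l[k]) • elemList (l.eraseIdx k) := by
  cases l with
  | nil => rw [elemList_nil, annihilation_vacuum]; rfl
  | cons x l =>
    refine (annihilation_elem q ξ (n := l.length) (x :: l).get).trans ?_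
    refine Finset.sum_congr rfl fun k _ => ?_
    rw [← elem_removeNth_get (x :: l) rfl k]
    rfl

theorem gauge_elemList (q : ℝ) (T : E →ₗ[ℂ] E) (l : List E) :
    gauge q T (elemList l) =
      ∑ k : Fin l.length, ((q : ℂ) ^ (k : ℕ)) • elemList (T l[k] :: l.eraseIdx k) := by
  cases l with
  | nil => rw [elemList_nil, gauge_vacuum]; rfl
  | cons x l =>
    refine (gauge_elem q T (n := l.length) (x :: l).get).trans ?_
    refine Finset.sum_congr rfl fun k _ => ?_
    rw [← creation_elem, ← creation_elemList, ← elem_removeNth_get (x :: l) rfl k]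
    rfl

theorem qInner_vacuum_elemList (q : ℝ) (l : List E) :
    qInner q (Fin.elim0 : Fin 0 → E) (elemList l) = if l = [] then 1 else 0 := by
  cases l with
  | nil =>
    rw [elemList_nil, vacuum, qInner_elem]
    simp [inversions]
  | cons x l =>
    rw [if_neg (List.cons_ne_nil x l), qInner, elemList, elem, LinearMap.comp_apply,
      DirectSum.component.of, dif_neg (by simp), map_zero]

end ListTensor

/-! ### Tensors indexed by finite sets of a linear order -/

section SortedTensor

variable {E : Type*} [NormedAddCommGroup E] [InnerProductSpace ℂ E]
variable {α : Type*} [LinearOrder α]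

theorem sort_erase_orderEmbOfFin [DecidableEq α] (O : Finset α) (k : Fin O.card) :
    (O.erase (O.orderEmbOfFin rfl k)).sort = O.sort.eraseIdx k := by
  refine List.SortedLT.eq_of_mem_iff (Finset.sortedLT_sort _) ?_ fun x => ?_
  · exact ((Finset.sortedLT_sort O).pairwise.sublist (List.eraseIdx_sublist _ _)).sortedLT
  · rw [Finset.mem_sort, Finset.mem_erase, Finset.orderEmbOfFin_apply,
      ← (Finset.sort_nodup O (· ≤ ·)).erase_getElem, (Finset.sort_nodup O (· ≤ ·)).mem_erase_iff,
      Finset.mem_sort]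
    rfl

/-- Turns the position in a tensor, which is the exponent of `q`, into a count of smaller labels,
the form in which it can be compared with crossings. -/
theorem card_filter_lt_orderEmbOfFin [DecidableLT α] (O : Finset α) (k : Fin O.card) :
    (O.filter (· < O.orderEmbOfFin rfl k)).card = k := by
  have : O.filter (· < O.orderEmbOfFin rfl k) =
      (Finset.Iio k).map (O.orderEmbOfFin rfl).toEmbedding := by
    ext x
    simp only [Finset.mem_filter, Finset.mem_map, Finset.mem_Iio, RelEmbedding.coe_toEmbedding]
    constructor
    · rintro ⟨hx, hlt⟩
      have : x ∈ Set.range (O.orderEmbOfFin rfl) := by rwa [Finset.range_orderEmbOfFin]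
      obtain ⟨j, rfl⟩ := this
      exact ⟨j, (O.orderEmbOfFin rfl).lt_iff_lt.1 hlt, rfl⟩
    · rintro ⟨j, hj, rfl⟩
      exact ⟨Finset.orderEmbOfFin_mem _ _ _, (O.orderEmbOfFin rfl).lt_iff_lt.2 hj⟩
  rw [this, Finset.card_map, Fin.card_Iio]

theorem sum_orderEmbOfFin {M : Type*} [AddCommMonoid M] (O : Finset α) (f : α → M) :
    ∑ k : Fin O.card, f (O.orderEmbOfFin rfl k) = ∑ x ∈ O, f x := by
  conv_rhs => rw [← Finset.map_orderEmbOfFin_univ O rfl, Finset.sum_map]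
  rfl

/-- The elementary tensor of the vectors `w x`, `x ∈ O`, in increasing order of `x`. -/
def sortedTensor (w : α → E) (O : Finset α) : AlgFock E := elemList (O.sort.map w)

theorem sortedTensor_insert [DecidableEq α] (w : α → E) {O : Finset α} {x : α} (hx : ∀ y ∈ O, x < y) :
    sortedTensor w (insert x O) = elemList (w x :: O.sort.map w) := by
  rw [sortedTensor, Finset.sort_insert _ (fun y hy => (hx y hy).le)
    (fun h => lt_irrefl _ (hx x h)), List.map_cons]

theorem annihilation_sortedTensor [DecidableEq α] [DecidableLT α] (q : ℝ) (ξ : E) (w : α → E)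
    (O : Finset α) :
    annihilation q ξ (sortedTensor w O) =
      ∑ x ∈ O, ((q : ℂ) ^ (O.filter (· < x)).card * inner ℂ ξ (w x)) •
        sortedTensor w (O.erase x) := by
  rw [← sum_orderEmbOfFin, sortedTensor, annihilation_elemList]
  refine Fintype.sum_equiv (finCongr (by simp)) _ _ fun k => ?_
  rw [card_filter_lt_orderEmbOfFin, sortedTensor, sort_erase_orderEmbOfFin, List.eraseIdx_map,
    Finset.orderEmbOfFin_apply]
  simp

/-- The new front vector has no label in `α` yet, so the result stays a list tensor; it becomes
sorted again once a smaller label carrying that vector is supplied. -/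
theorem gauge_sortedTensor [DecidableEq α] [DecidableLT α] (q : ℝ) (T : E →ₗ[ℂ] E) (w : α → E)
    (O : Finset α) :
    gauge q T (sortedTensor w O) =
      ∑ x ∈ O, ((q : ℂ) ^ (O.filter (· < x)).card) •
        elemList (T (w x) :: (O.erase x).sort.map w) := by
  rw [← sum_orderEmbOfFin, sortedTensor, gauge_elemList]
  refine Fintype.sum_equiv (finCongr (by simp)) _ _ fun k => ?_
  rw [card_filter_lt_orderEmbOfFin, sort_erase_orderEmbOfFin, List.eraseIdx_map,
    Finset.orderEmbOfFin_apply]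
  simp

theorem qInner_vacuum_sortedTensor [DecidableEq α] (q : ℝ) (w : α → E) (O : Finset α) :
    qInner q (Fin.elim0 : Fin 0 → E) (sortedTensor w O) = if O = ∅ then 1 else 0 := by
  rw [sortedTensor, qInner_vacuum_elemList]
  congr 1
  rw [List.map_eq_nil_iff, ← List.length_eq_zero_iff, Finset.length_sort, Finset.card_eq_zero]

end SortedTensor

/-! ### Partitions as families of increasing lists, built by prepending a minimum -/

section ListPartition

variable {ι : Type*} [LinearOrder ι]

/-- The families of increasing lists which partition the set of entries of `s`
(see `mem_listPartitions`). -/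
def listPartitions : List ι → Finset (Finset (List ι))
  | [] => {∅}
  | a :: s => (listPartitions s).image (insert [a]) ∪
      (listPartitions s).biUnion fun C => C.image fun B => insert (a :: B) (C.erase B)

/-- `C` is a family of nonempty increasing lists which partitions the set of entries of `s`. -/
structure IsListPartition (s : List ι) (C : Finset (List ι)) : Prop where
  ne_nil : ∀ l ∈ C, l ≠ []
  sorted : ∀ l ∈ C, l.Pairwise (· < ·)
  mem : ∀ l ∈ C, ∀ x ∈ l, x ∈ s
  cover : ∀ x ∈ s, ∃ l ∈ C, x ∈ l
  unique : ∀ l ∈ C, ∀ l' ∈ C, ∀ x ∈ l, x ∈ l' → l = l'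

namespace IsListPartition

variable {a : ι} {s : List ι} {C : Finset (List ι)}

theorem insert_singleton (h : IsListPartition s C) (ha : ∀ x ∈ s, a < x) :
    IsListPartition (a :: s) (insert [a] C) := by
  have ha' : a ∉ s := fun h => lt_irrefl _ (ha a h)
  constructor
  · intro l hl
    rcases Finset.mem_insert.1 hl with rfl | hl
    · simp
    · exact h.ne_nil l hl
  · intro l hl
    rcases Finset.mem_insert.1 hl with rfl | hl
    · simp
    · exact h.sorted l hl
  · intro l hl x hx
    rcases Finset.mem_insert.1 hl with rfl | hl
    · simp_all
    · exact List.mem_cons_of_mem _ (h.mem l hl x hx)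
  · intro x hx
    rcases List.mem_cons.1 hx with rfl | hx
    · exact ⟨[x], by simp⟩
    · obtain ⟨l, hl, hxl⟩ := h.cover x hx
      exact ⟨l, by simp [hl], hxl⟩
  · intro l hl l' hl' x hx hx'
    rcases Finset.mem_insert.1 hl with rfl | hl <;> rcases Finset.mem_insert.1 hl' with rfl | hl'
    · rfl
    · rw [List.mem_singleton.1 hx] at hx'
      exact absurd (h.mem _ hl' _ hx') ha'
    · rw [List.mem_singleton.1 hx'] at hx
      exact absurd (h.mem _ hl _ hx) ha'
    · exact h.unique l hl l' hl' x hx hx'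

theorem insert_cons (h : IsListPartition s C) (ha : ∀ x ∈ s, a < x) {B : List ι} (hB : B ∈ C) :
    IsListPartition (a :: s) (insert (a :: B) (C.erase B)) := by
  have ha' : a ∉ s := fun h => lt_irrefl _ (ha a h)
  constructor
  · intro l hl
    rcases Finset.mem_insert.1 hl with rfl | hl
    · simp
    · exact h.ne_nil l (Finset.mem_of_mem_erase hl)
  · intro l hl
    rcases Finset.mem_insert.1 hl with rfl | hl
    · exact List.pairwise_cons.2 ⟨fun x hx => ha x (h.mem B hB x hx), h.sorted B hB⟩
    · exact h.sorted l (Finset.mem_of_mem_erase hl)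
  · intro l hl x hx
    rcases Finset.mem_insert.1 hl with rfl | hl
    · rcases List.mem_cons.1 hx with rfl | hx
      · simp
      · exact List.mem_cons_of_mem _ (h.mem B hB x hx)
    · exact List.mem_cons_of_mem _ (h.mem l (Finset.mem_of_mem_erase hl) x hx)
  · intro x hx
    rcases List.mem_cons.1 hx with rfl | hx
    · exact ⟨x :: B, by simp⟩
    · obtain ⟨l, hl, hxl⟩ := h.cover x hx
      by_cases hlB : l = B
      · subst hlB
        exact ⟨a :: l, by simp, by simp [hxl]⟩
      · exact ⟨l, by simp [hl, hlB], hxl⟩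
  · have key : ∀ l ∈ C.erase B, ∀ x ∈ a :: B, x ∉ l := by
      intro l hl x hx hxl
      rw [Finset.mem_erase] at hl
      rcases List.mem_cons.1 hx with rfl | hx
      · exact ha' (h.mem l hl.2 _ hxl)
      · exact hl.1 (h.unique l hl.2 B hB x hxl hx)
    intro l hl l' hl' x hx hx'
    rcases Finset.mem_insert.1 hl with rfl | hl <;> rcases Finset.mem_insert.1 hl' with rfl | hl'
    · rfl
    · exact absurd hx' (key l' hl' x hx)
    · exact absurd hx (key l hl x hx')
    · exact h.unique l (Finset.mem_of_mem_erase hl) l' (Finset.mem_of_mem_erase hl') x hx hx'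

/-- The lists are increasing and `a` is the minimum, so it can only stand first in its list. -/
theorem exists_cons_mem (h : IsListPartition (a :: s) C) (ha : ∀ x ∈ s, a < x) :
    ∃ B, a :: B ∈ C := by
  obtain ⟨l, hl, hal⟩ := h.cover a (by simp)
  obtain _ | ⟨b, B⟩ := l
  · simp at hal
  rcases List.mem_cons.1 hal with rfl | haB
  · exact ⟨B, hl⟩
  · have hba : b < a := (List.pairwise_cons.1 (h.sorted _ hl)).1 a haB
    rcases List.mem_cons.1 (h.mem _ hl b (by simp)) with rfl | hb
    · exact absurd hba (lt_irrefl _)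
    · exact absurd hba (ha b hb).asymm

/-- Deleting `a` from its list undoes the recursion; the two cases are whether this list was a
singleton. -/
theorem exists_of_cons (h : IsListPartition (a :: s) C) (ha : ∀ x ∈ s, a < x) :
    ∃ C', IsListPartition s C' ∧
      (insert [a] C' = C ∨ ∃ B ∈ C', insert (a :: B) (C'.erase B) = C) := by
  have ha' : a ∉ s := fun h => lt_irrefl _ (ha a h)
  obtain ⟨B, hB⟩ := h.exists_cons_mem ha
  have mem_of : ∀ l ∈ C.erase (a :: B), ∀ x ∈ l, x ∈ s := by
    intro l hl x hx
    rw [Finset.mem_erase] at hl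
    rcases List.mem_cons.1 (h.mem l hl.2 x hx) with rfl | hx'
    · exact absurd (h.unique l hl.2 _ hB x hx (by simp)) hl.1
    · exact hx'
  have hBs : ∀ x ∈ B, x ∈ s := by
    intro x hx
    rcases List.mem_cons.1 (h.mem _ hB x (by simp [hx])) with rfl | hx'
    · exact absurd ((List.pairwise_cons.1 (h.sorted _ hB)).1 x hx) (lt_irrefl _)
    · exact hx'
  by_cases hnil : B = []
  · subst hnil
    refine ⟨C.erase [a], ⟨?_, ?_, mem_of, ?_, ?_⟩, Or.inl (Finset.insert_erase hB)⟩
    · exact fun l hl => h.ne_nil l (Finset.mem_of_mem_erase hl)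
    · exact fun l hl => h.sorted l (Finset.mem_of_mem_erase hl)
    · intro x hx
      obtain ⟨l, hl, hxl⟩ := h.cover x (by simp [hx])
      refine ⟨l, Finset.mem_erase.2 ⟨?_, hl⟩, hxl⟩
      rintro rfl
      rw [List.mem_singleton] at hxl
      exact ha' (hxl ▸ hx)
    · exact fun l hl l' hl' =>
        h.unique l (Finset.mem_of_mem_erase hl) l' (Finset.mem_of_mem_erase hl')
  · have key : ∀ l ∈ C.erase (a :: B), ∀ x ∈ B, x ∉ l := by
      intro l hl x hx hxl
      rw [Finset.mem_erase] at hl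
      exact hl.1 (h.unique l hl.2 _ hB x hxl (by simp [hx]))
    have hBC : B ∉ C.erase (a :: B) := by
      intro hmem
      obtain ⟨x, hx⟩ := List.exists_mem_of_ne_nil B hnil
      exact key B hmem x hx hx
    refine ⟨insert B (C.erase (a :: B)), ⟨?_, ?_, ?_, ?_, ?_⟩,
      Or.inr ⟨B, by simp, by rw [Finset.erase_insert hBC, Finset.insert_erase hB]⟩⟩
    · intro l hl
      rcases Finset.mem_insert.1 hl with rfl | hl
      · exact hnil
      · exact h.ne_nil l (Finset.mem_of_mem_erase hl)
    · intro l hl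
      rcases Finset.mem_insert.1 hl with rfl | hl
      · exact (List.pairwise_cons.1 (h.sorted _ hB)).2
      · exact h.sorted l (Finset.mem_of_mem_erase hl)
    · intro l hl
      rcases Finset.mem_insert.1 hl with rfl | hl
      · exact hBs
      · exact mem_of l hl
    · intro x hx
      obtain ⟨l, hl, hxl⟩ := h.cover x (by simp [hx])
      by_cases hlB : l = a :: B
      · subst hlB
        rcases List.mem_cons.1 hxl with rfl | hxl
        · exact absurd hx ha'
        · exact ⟨B, by simp, hxl⟩
      · exact ⟨l, by simp [hl, hlB], hxl⟩
    · intro l hl l' hl' x hx hx'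
      rcases Finset.mem_insert.1 hl with rfl | hl <;> rcases Finset.mem_insert.1 hl' with rfl | hl'
      · rfl
      · exact absurd hx' (key l' hl' x hx)
      · exact absurd hx (key l hl x hx')
      · exact h.unique l (Finset.mem_of_mem_erase hl) l' (Finset.mem_of_mem_erase hl') x hx hx'

end IsListPartition

theorem mem_listPartitions {s : List ι} (hs : s.Pairwise (· < ·)) {C : Finset (List ι)} :
    C ∈ listPartitions s ↔ IsListPartition s C := by
  induction s generalizing C with
  | nil =>
    rw [listPartitions, Finset.mem_singleton]
    constructor
    · rintro rfl
      constructor <;> simp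
    · intro h
      refine Finset.eq_empty_of_forall_notMem fun l hl => ?_
      obtain ⟨x, hx⟩ := List.exists_mem_of_ne_nil l (h.ne_nil l hl)
      exact List.not_mem_nil (h.mem l hl x hx)
  | cons a s ih =>
    obtain ⟨ha, hs⟩ := List.pairwise_cons.1 hs
    rw [listPartitions]
    simp only [Finset.mem_union, Finset.mem_image, Finset.mem_biUnion, ih hs]
    constructor
    · rintro (⟨C', hC', rfl⟩ | ⟨C', hC', B, hB, rfl⟩)
      · exact hC'.insert_singleton ha
      · exact hC'.insert_cons ha hB
    · intro h
      obtain ⟨C', hC', h | ⟨B, hB, h⟩⟩ := h.exists_of_cons ha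
      · exact Or.inl ⟨C', hC', h⟩
      · exact Or.inr ⟨C', hC', B, hB, h⟩

theorem cons_notMem_of_isListPartition {a : ι} {s : List ι} (ha : a ∉ s) {C : Finset (List ι)}
    (hC : IsListPartition s C) (B : List ι) : a :: B ∉ C :=
  fun h => ha (hC.mem _ h a (by simp))

/-- The recursion produces no partition twice: the list headed by `a` is unique, its tail is the old
block, and old blocks are nonempty, which separates the two cases. -/
theorem sum_listPartitions_cons {M : Type*} [AddCommMonoid M] {a : ι} {s : List ι}
    (hs : (a :: s).Pairwise (· < ·)) (f : Finset (List ι) → M) :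
    ∑ C ∈ listPartitions (a :: s), f C =
      ∑ C ∈ listPartitions s,
        (f (insert [a] C) + ∑ B ∈ C, f (insert (a :: B) (C.erase B))) := by
  obtain ⟨ha, hs⟩ := List.pairwise_cons.1 hs
  have ha' : a ∉ s := fun h => lt_irrefl _ (ha a h)
  have hnot : ∀ C ∈ listPartitions s, ∀ B, a :: B ∉ C := fun C hC B =>
    cons_notMem_of_isListPartition ha' ((mem_listPartitions hs).1 hC) B
  have hnot' : ∀ C ∈ listPartitions s, ∀ B B', a :: B ∉ C.erase B' := fun C hC B B' h =>
    hnot C hC B (Finset.mem_of_mem_erase h)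
  have hinj : ∀ C ∈ listPartitions s, ∀ B ∈ C, ∀ C' ∈ listPartitions s, ∀ B' ∈ C',
      insert (a :: B) (C.erase B) = insert (a :: B') (C'.erase B') → B = B' ∧ C = C' := by
    intro C hC B hB C' hC' B' hB' h
    have hBB : B = B' := by
      have : a :: B ∈ insert (a :: B') (C'.erase B') := h ▸ Finset.mem_insert_self _ _
      rcases Finset.mem_insert.1 this with h | h
      · exact (List.cons.inj h).2
      · exact absurd h (hnot' C' hC' _ _)
    subst hBB
    refine ⟨rfl, ?_⟩
    rw [← Finset.insert_erase hB, ← Finset.insert_erase hB',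
      ← Finset.erase_insert (hnot' C hC B B), h, Finset.erase_insert (hnot' C' hC' B B)]
  rw [listPartitions, Finset.sum_union, Finset.sum_add_distrib]
  · congr 1
    · refine Finset.sum_image fun C hC C' hC' h => ?_
      rw [← Finset.erase_insert (hnot C hC []), h, Finset.erase_insert (hnot C' hC' [])]
    · rw [Finset.sum_biUnion]
      · refine Finset.sum_congr rfl fun C hC => Finset.sum_image fun B hB B' hB' h => ?_
        exact (hinj C hC B hB C hC B' hB' h).1
      · intro C hC C' hC' hne
        refine Finset.disjoint_left.2 fun F hF hF' => hne ?_
        obtain ⟨B, hB, rfl⟩ := Finset.mem_image.1 hF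
        obtain ⟨B', hB', h⟩ := Finset.mem_image.1 hF'
        exact (hinj C hC B hB C' hC' B' hB' h.symm).2
  · refine Finset.disjoint_left.2 fun F hF hF' => ?_
    obtain ⟨C, hC, rfl⟩ := Finset.mem_image.1 hF
    obtain ⟨C', hC', hF'⟩ := Finset.mem_biUnion.1 hF'
    obtain ⟨B, hB, h⟩ := Finset.mem_image.1 hF'
    have : a :: B ∈ insert [a] C := h ▸ Finset.mem_insert_self _ _
    rcases Finset.mem_insert.1 this with h | h
    · exact ((mem_listPartitions hs).1 hC').ne_nil B hB (List.cons.inj h).2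
    · exact hnot C hC B h

/-- A block to be extended and a set of other marked blocks amount to a marked set with a
distinguished member: the extended block was open beforehand. -/
theorem sum_powerset_erase_comm {α M : Type*} [DecidableEq α] [AddCommMonoid M] (C : Finset α)
    (g : α → Finset α → M) :
    ∑ B ∈ C, ∑ O ∈ (C.erase B).powerset, g B O =
      ∑ O ∈ C.powerset, ∑ B ∈ O, g B (O.erase B) := by
  rw [Finset.sum_sigma', Finset.sum_sigma']
  refine Finset.sum_bij' (fun x _ => ⟨insert x.1 x.2, x.1⟩) (fun x _ => ⟨x.2, x.1.erase x.2⟩)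
    ?_ ?_ ?_ ?_ ?_
  · rintro ⟨B, O⟩ h
    simp only [Finset.mem_sigma, Finset.mem_powerset] at h ⊢
    exact ⟨Finset.insert_subset h.1 (h.2.trans (Finset.erase_subset _ _)),
      Finset.mem_insert_self _ _⟩
  · rintro ⟨O, B⟩ h
    simp only [Finset.mem_sigma, Finset.mem_powerset] at h ⊢
    exact ⟨h.1 h.2, Finset.erase_subset_erase _ h.1⟩
  · rintro ⟨B, O⟩ h
    simp only [Finset.mem_sigma, Finset.mem_powerset] at h
    have hBO : B ∉ O := fun hb => Finset.notMem_erase _ _ (h.2 hb)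
    simp [Finset.erase_insert hBO]
  · rintro ⟨O, B⟩ h
    simp only [Finset.mem_sigma, Finset.mem_powerset] at h
    simp [Finset.insert_erase h.2]
  · rintro ⟨B, O⟩ h
    simp only [Finset.mem_sigma, Finset.mem_powerset] at h
    have hBO : B ∉ O := fun hb => Finset.notMem_erase _ _ (h.2 hb)
    simp [Finset.erase_insert hBO]

/-- The sum over all list partitions of `a :: s` with some of their lists marked, in terms of
marked list partitions of `s`. -/
theorem sum_marked_listPartitions_cons {M : Type*} [AddCommMonoid M] {a : ι} {s : List ι}
    (hs : (a :: s).Pairwise (· < ·)) (f : Finset (List ι) → Finset (List ι) → M) :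
    ∑ C ∈ listPartitions (a :: s), ∑ O ∈ C.powerset, f C O =
      ∑ C ∈ listPartitions s, ∑ O ∈ C.powerset,
        (f (insert [a] C) O + f (insert [a] C) (insert [a] O) +
          ∑ B ∈ O, (f (insert (a :: B) (C.erase B)) (O.erase B) +
            f (insert (a :: B) (C.erase B)) (insert (a :: B) (O.erase B)))) := by
  have ha' : a ∉ s := fun h => lt_irrefl _ ((List.pairwise_cons.1 hs).1 a h)
  rw [sum_listPartitions_cons hs]
  refine Finset.sum_congr rfl fun C hC => ?_
  have hnot := cons_notMem_of_isListPartition ha' ((mem_listPartitions hs.of_cons).1 hC)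
  rw [Finset.sum_add_distrib, Finset.sum_powerset_insert (hnot []), Finset.sum_add_distrib,
    ← sum_powerset_erase_comm C fun B O => f (insert (a :: B) (C.erase B)) O +
      f (insert (a :: B) (C.erase B)) (insert (a :: B) O)]
  congr 1
  refine Finset.sum_congr rfl fun B hB => ?_
  rw [Finset.sum_powerset_insert fun h => hnot B (Finset.mem_of_mem_erase h),
    Finset.sum_add_distrib]

end ListPartition

/-! ### Crossing statistics of marked partitions -/

section Crossings

theorem pair_infix_cons_cons {ι : Type*} (i j a x : ι) (B : List ι) :
    [i, j] <:+: a :: x :: B ↔ [i, j] <:+: x :: B ∨ i = a ∧ j = x := by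
  rw [List.infix_cons_iff, or_comm]
  simp

variable {ι : Type*} [LinearOrder ι]

open Classical in
/-- The number of triples `(i, j, t)` with an arc `i ∼ j` and `i < t < j`, such that `t` is marked
or the right end of an arc which starts before `i`. -/
def crossingCount [Fintype ι] (arc : ι → ι → Prop) (mark : ι → Prop) : ℕ :=
  (Finset.univ.filter fun x : ι × ι × ι =>
    arc x.1 x.2.1 ∧ x.1 < x.2.2 ∧ x.2.2 < x.2.1 ∧ (mark x.2.2 ∨ ∃ s < x.1, arc s x.2.2)).card

theorem crossingCount_congr [Fintype ι] {arc arc' : ι → ι → Prop} {mark mark' : ι → Prop}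
    (harc : ∀ i j, arc i j ↔ arc' i j)
    (hmark : ∀ i t j, arc i j → i < t → t < j → (mark t ↔ mark' t)) :
    crossingCount arc mark = crossingCount arc' mark' := by
  obtain rfl : arc = arc' := by
    funext i j
    exact propext (harc i j)
  unfold crossingCount
  congr 1
  ext ⟨i, j, t⟩
  simp only [Finset.mem_filter, Finset.mem_univ, true_and]
  constructor
  · rintro ⟨h, hit, htj, ht⟩
    exact ⟨h, hit, htj, by rwa [← hmark i t j h hit htj]⟩
  · rintro ⟨h, hit, htj, ht⟩
    exact ⟨h, hit, htj, by rwa [hmark i t j h hit htj]⟩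

open Classical in
/-- The effect on the number of crossings of a new leftmost arc from `a` to a marked point `x`
which loses its mark. -/
theorem crossingCount_insert_arc [Fintype ι] {arc arc' : ι → ι → Prop} {mark mark' : ι → Prop}
    {a x : ι} (harc : ∀ i j, arc i j → a < i) (hax : a < x)
    (harc' : ∀ i j, arc' i j ↔ arc i j ∨ i = a ∧ j = x) (hx : mark x)
    (hmark : ∀ t, a < t → t ≠ x → (mark' t ↔ mark t)) :
    crossingCount arc' mark' =
      crossingCount arc mark +
        (Finset.univ.filter fun t => a < t ∧ t < x ∧ mark t).card := by
  have hinj : Function.Injective fun t : ι => (a, x, t) := fun t t' h => by simpa using h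
  rw [crossingCount, crossingCount, ← Finset.card_image_of_injective _ hinj,
    ← Finset.card_union_of_disjoint]
  · congr 1
    ext ⟨i, j, t⟩
    simp only [Finset.mem_filter, Finset.mem_univ, true_and, Finset.mem_union, Finset.mem_image,
      Prod.mk.injEq]
    constructor
    · rintro ⟨h, hit, htj, ht⟩
      rcases (harc' i j).1 h with h | ⟨rfl, rfl⟩
      · have hai := harc i j h
        refine Or.inl ⟨h, hit, htj, ?_⟩
        -- The point `x` stays counted under old arcs: its mark is replaced by the arc from `a`,
        -- which starts to the left of every old arc.
        by_cases htx : t = x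
        · subst htx
          exact Or.inl hx
        · rcases ht with ht | ⟨s, hs, ht⟩
          · exact Or.inl ((hmark t (hai.trans hit) htx).1 ht)
          · rcases (harc' s t).1 ht with ht | ⟨-, ht⟩
            · exact Or.inr ⟨s, hs, ht⟩
            · exact absurd ht htx
      · refine Or.inr ⟨t, ⟨hit, htj, ?_⟩, rfl, rfl, rfl⟩
        rcases ht with ht | ⟨s, hs, ht⟩
        · exact (hmark t hit htj.ne).1 ht
        · rcases (harc' s t).1 ht with ht | ⟨-, ht⟩
          · exact absurd (harc s t ht) hs.asymm
          · exact absurd ht htj.ne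
    · rintro (⟨h, hit, htj, ht⟩ | ⟨t, ⟨hat, htx, ht⟩, rfl, rfl, rfl⟩)
      · have hai := harc i j h
        refine ⟨(harc' i j).2 (Or.inl h), hit, htj, ?_⟩
        by_cases htx : t = x
        · exact Or.inr ⟨a, hai, (harc' a t).2 (Or.inr ⟨rfl, htx⟩)⟩
        · rcases ht with ht | ⟨s, hs, ht⟩
          · exact Or.inl ((hmark t (hai.trans hit) htx).2 ht)
          · exact Or.inr ⟨s, hs, (harc' s t).2 (Or.inl ht)⟩
      · exact ⟨(harc' a x).2 (Or.inr ⟨rfl, rfl⟩), hat, htx, Or.inl ((hmark t hat htx.ne).2 ht)⟩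
  · refine Finset.disjoint_left.2 fun y hy hy' => ?_
    obtain ⟨t, -, rfl⟩ := Finset.mem_image.1 hy'
    exact lt_irrefl _ (harc _ _ (Finset.mem_filter.1 hy).2.1)

/-- `i` and `j` are consecutive entries of a list of the family `C`. -/
def FamilyArc (C : Finset (List ι)) (i j : ι) : Prop := ∃ l ∈ C, [i, j] <:+: l

/-- `t` is the first entry of a list of the family `O`. -/
def FamilyHead (O : Finset (List ι)) (t : ι) : Prop := ∃ l ∈ O, l.head? = some t

theorem familyArc_insert_singleton (a : ι) (C : Finset (List ι)) (i j : ι) :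
    FamilyArc (insert [a] C) i j ↔ FamilyArc C i j := by
  simp [FamilyArc, List.infix_cons_iff]

theorem familyArc_insert_cons {C : Finset (List ι)} {x : ι} {B : List ι} (hB : x :: B ∈ C)
    (a i j : ι) :
    FamilyArc (insert (a :: x :: B) (C.erase (x :: B))) i j ↔
      FamilyArc C i j ∨ i = a ∧ j = x := by
  constructor
  · rintro ⟨l, hl, h⟩
    rcases Finset.mem_insert.1 hl with rfl | hl
    · rcases (pair_infix_cons_cons i j a x B).1 h with h | h
      · exact Or.inl ⟨_, hB, h⟩
      · exact Or.inr h
    · exact Or.inl ⟨l, Finset.mem_of_mem_erase hl, h⟩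
  · rintro (⟨l, hl, h⟩ | h)
    · by_cases hlB : l = x :: B
      · subst hlB
        exact ⟨_, Finset.mem_insert_self _ _, (pair_infix_cons_cons i j a x B).2 (Or.inl h)⟩
      · exact ⟨l, by simp [hl, hlB], h⟩
    · exact ⟨_, Finset.mem_insert_self _ _, (pair_infix_cons_cons i j a x B).2 (Or.inr h)⟩

theorem IsListPartition.lt_of_familyArc {a : ι} {s : List ι} {C : Finset (List ι)}
    (h : IsListPartition s C) (ha : ∀ x ∈ s, a < x) {i j : ι} (hij : FamilyArc C i j) : a < i := by
  obtain ⟨l, hl, hij⟩ := hij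
  exact ha i (h.mem l hl i (hij.subset (by simp)))

theorem familyHead_insert {a t : ι} (hat : a < t) (B : List ι) (O : Finset (List ι)) :
    FamilyHead (insert (a :: B) O) t ↔ FamilyHead O t := by
  simp [FamilyHead, hat.ne]

theorem familyHead_erase {O : Finset (List ι)} {x : ι} {B : List ι} {t : ι} (htx : t ≠ x) :
    FamilyHead (O.erase (x :: B)) t ↔ FamilyHead O t := by
  constructor
  · rintro ⟨l, hl, ht⟩
    exact ⟨l, Finset.mem_of_mem_erase hl, ht⟩
  · rintro ⟨l, hl, ht⟩
    refine ⟨l, Finset.mem_erase.2 ⟨?_, hl⟩, ht⟩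
    rintro rfl
    exact htx (by simpa using ht.symm)

/-- The exponent of `q` which belongs to a list partition `C` with marked lists `O`. -/
def markedCrossings [Fintype ι] (C O : Finset (List ι)) : ℕ :=
  crossingCount (FamilyArc C) (FamilyHead O)

/-- Distinct lists of the family are disjoint, so the lexicographic order is decided by the first
entries; sorting blocks lexicographically sorts them by minimum. -/
theorem IsListPartition.cons_lt_iff {s : List ι} {C : Finset (List ι)} (h : IsListPartition s C)
    {x y : ι} {B B' : List ι} (hB : x :: B ∈ C) (hB' : y :: B' ∈ C) :
    x :: B < y :: B' ↔ x < y := by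
  rw [List.cons_lt_cons_iff]
  constructor
  · rintro (hlt | ⟨rfl, hlt⟩)
    · exact hlt
    · have := h.unique _ hB _ hB' x (by simp) (by simp)
      rw [(List.cons.inj this).2] at hlt
      exact absurd hlt (lt_irrefl _)
  · exact Or.inl

open Classical in
-- Matches the crossings gained by the arc `(a, x)` with the tensor position of the block headed by
-- `x`.
theorem IsListPartition.card_familyHead [Fintype ι] {a : ι} {s : List ι} {C O : Finset (List ι)}
    (h : IsListPartition s C) (ha : ∀ x ∈ s, a < x) (hO : O ⊆ C) {x : ι} {B : List ι}
    (hB : x :: B ∈ O) :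
    (Finset.univ.filter fun t => a < t ∧ t < x ∧ FamilyHead O t).card =
      (O.filter (· < x :: B)).card := by
  symm
  refine Finset.card_bij (fun l hl => l.head (h.ne_nil l (hO (Finset.mem_filter.1 hl).1)))
    ?_ ?_ ?_
  · intro l hl
    obtain ⟨hl, hlt⟩ := Finset.mem_filter.1 hl
    obtain _ | ⟨y, l⟩ := l
    · exact absurd rfl (h.ne_nil _ (hO hl))
    rw [h.cons_lt_iff (hO hl) (hO hB)] at hlt
    simp only [Finset.mem_filter, Finset.mem_univ, true_and, List.head_cons]
    exact ⟨ha y (h.mem _ (hO hl) y (by simp)), hlt, _, hl, rfl⟩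
  · intro l hl l' hl' heq
    have h1 := hO (Finset.mem_filter.1 hl).1
    have h2 := hO (Finset.mem_filter.1 hl').1
    exact h.unique l h1 l' h2 _ (List.head_mem (h.ne_nil l h1))
      (heq ▸ List.head_mem (h.ne_nil l' h2))
  · intro t ht
    obtain ⟨-, -, htx, l, hl, hlt⟩ := Finset.mem_filter.1 ht
    obtain _ | ⟨y, l⟩ := l
    · simp at hlt
    obtain rfl : y = t := by simpa using hlt
    exact ⟨y :: l, Finset.mem_filter.2 ⟨hl, (h.cons_lt_iff (hO hl) (hO hB)).2 htx⟩, rfl⟩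

namespace IsListPartition

variable [Fintype ι] {a : ι} {s : List ι} {C O : Finset (List ι)}

theorem markedCrossings_insert_singleton (C O : Finset (List ι)) (a : ι) :
    markedCrossings (insert [a] C) O = markedCrossings C O :=
  crossingCount_congr (familyArc_insert_singleton a C) fun _ _ _ _ _ _ => Iff.rfl

theorem markedCrossings_insert_singleton_insert (h : IsListPartition s C) (ha : ∀ x ∈ s, a < x) :
    markedCrossings (insert [a] C) (insert [a] O) = markedCrossings C O :=
  crossingCount_congr (familyArc_insert_singleton a C) fun i _ j hij hit _ =>
    familyHead_insert ((h.lt_of_familyArc ha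
      ((familyArc_insert_singleton a C i j).1 hij)).trans hit) _ _

theorem markedCrossings_insert_cons (h : IsListPartition s C) (ha : ∀ x ∈ s, a < x) (hO : O ⊆ C)
    {B : List ι} (hB : B ∈ O) :
    markedCrossings (insert (a :: B) (C.erase B)) (O.erase B) =
      markedCrossings C O + (O.filter (· < B)).card := by
  obtain _ | ⟨x, B⟩ := B
  · exact absurd rfl (h.ne_nil _ (hO hB))
  rw [← h.card_familyHead ha hO hB]
  exact crossingCount_insert_arc (fun i j => h.lt_of_familyArc ha)
    (ha x (h.mem _ (hO hB) x (by simp))) (familyArc_insert_cons (hO hB) a) ⟨_, hB, rfl⟩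
    fun _ _ htx => familyHead_erase htx

/-- Keeping the extended block open changes nothing: its head `a` is minimal, hence under no arc.
Gauge and annihilation therefore share the same exponent. -/
theorem markedCrossings_insert_cons_insert (h : IsListPartition s C) (ha : ∀ x ∈ s, a < x)
    (hO : O ⊆ C) {B : List ι} (hB : B ∈ O) :
    markedCrossings (insert (a :: B) (C.erase B)) (insert (a :: B) (O.erase B)) =
      markedCrossings C O + (O.filter (· < B)).card := by
  rw [← h.markedCrossings_insert_cons ha hO hB]
  exact crossingCount_congr (fun _ _ => Iff.rfl) fun i _ j hij hit _ =>
    familyHead_insert (lt_of_le_of_lt (by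
      obtain ⟨l, hl, hij⟩ := hij
      rcases List.mem_cons.1 ((h.insert_cons ha (hO hB)).mem l hl i (hij.subset (by simp)))
        with rfl | hi
      · exact le_rfl
      · exact (ha i hi).le) hit) _ _

end IsListPartition

end Crossings

/-! ### Expansion of operator products on the vacuum -/

section Moments

variable {E : Type*} [NormedAddCommGroup E] [InnerProductSpace ℂ E]
variable {ι : Type*}

/-- The vector `S_{i₁} ⋯ S_{i_{k-1}} ξ_{i_k}`. -/
def chainVector (ξ : ι → E) (S : ι → E →ₗ[ℂ] E) : List ι → E
  | [] => 0
  | [i] => ξ i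
  | i :: j :: l => S i (chainVector ξ S (j :: l))

/-- The cumulant `⟨ξ_{i₁}, S_{i₂} ⋯ S_{i_{k-1}} ξ_{i_k}⟩` of a block, resp. `λ_i` for a
singleton. -/
def blockWeight (ξ : ι → E) (S : ι → E →ₗ[ℂ] E) (lam : ι → ℂ) : List ι → ℂ
  | [] => 1
  | [i] => lam i
  | i :: j :: l => inner ℂ (ξ i) (chainVector ξ S (j :: l))

theorem chainVector_cons (ξ : ι → E) (S : ι → E →ₗ[ℂ] E) (i : ι) {l : List ι} (hl : l ≠ []) :
    chainVector ξ S (i :: l) = S i (chainVector ξ S l) := by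
  cases l with
  | nil => exact absurd rfl hl
  | cons => rfl

theorem blockWeight_cons (ξ : ι → E) (S : ι → E →ₗ[ℂ] E) (lam : ι → ℂ) (i : ι) {l : List ι}
    (hl : l ≠ []) :
    blockWeight ξ S lam (i :: l) = inner ℂ (ξ i) (chainVector ξ S l) := by
  cases l with
  | nil => exact absurd rfl hl
  | cons => rfl

/-- The operator `L*(ξ) + L(ξ) + γ(S) + λ`. -/
def fieldOperator (q : ℝ) (ξ : E) (S : E →ₗ[ℂ] E) (c : ℂ) : Module.End ℂ (AlgFock E) :=
  annihilation q ξ + creation ξ + gauge q S + c • (1 : Module.End ℂ (AlgFock E))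

variable [LinearOrder ι] [Fintype ι]

/-- The contribution of a list partition `C` with marked lists `O` to the vector
`X_{i₁} ⋯ X_{i_n} Ω`. -/
def markedTerm (q : ℝ) (ξ : ι → E) (S : ι → E →ₗ[ℂ] E) (lam : ι → ℂ) (C O : Finset (List ι)) :
    AlgFock E :=
  ((q : ℂ) ^ markedCrossings C O * ∏ B ∈ C \ O, blockWeight ξ S lam B) •
    sortedTensor (chainVector ξ S) O

theorem fieldOperator_markedTerm (q : ℝ) (ξ : ι → E) (S : ι → E →ₗ[ℂ] E) (lam : ι → ℂ)
    {a : ι} {s : List ι} (ha : ∀ x ∈ s, a < x) {C O : Finset (List ι)}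
    (h : IsListPartition s C) (hO : O ⊆ C) :
    fieldOperator q (ξ a) (S a) (lam a) (markedTerm q ξ S lam C O) =
      markedTerm q ξ S lam (insert [a] C) O +
      markedTerm q ξ S lam (insert [a] C) (insert [a] O) +
      ∑ B ∈ O, (markedTerm q ξ S lam (insert (a :: B) (C.erase B)) (O.erase B) +
        markedTerm q ξ S lam (insert (a :: B) (C.erase B)) (insert (a :: B) (O.erase B))) := by
  have ha' : a ∉ s := fun h => lt_irrefl _ (ha a h)
  have hnot := cons_notMem_of_isListPartition ha' h
  -- A list headed by `a` precedes all open blocks, matching the front position where creation and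
  -- gauge put their vector.
  have hlt : ∀ B, ∀ l ∈ O, a :: B < l := by
    intro B l hl
    obtain _ | ⟨y, l⟩ := l
    · exact absurd rfl (h.ne_nil _ (hO hl))
    · exact List.cons_lt_cons_iff.2 (Or.inl (ha y (h.mem _ (hO hl) y (by simp))))
  have hclosed : markedTerm q ξ S lam (insert [a] C) O = lam a • markedTerm q ξ S lam C O := by
    rw [markedTerm, markedTerm, IsListPartition.markedCrossings_insert_singleton,
      Finset.insert_sdiff_of_notMem _ (fun h => hnot [] (hO h)),
      Finset.prod_insert (fun h => hnot [] (Finset.mem_sdiff.1 h).1), smul_smul, blockWeight]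
    congr 1
    ring
  have hopen : markedTerm q ξ S lam (insert [a] C) (insert [a] O) =
      creation (ξ a) (markedTerm q ξ S lam C O) := by
    rw [markedTerm, markedTerm, h.markedCrossings_insert_singleton_insert ha, map_smul,
      sortedTensor_insert _ (hlt []), sortedTensor, creation_elemList, chainVector,
      Finset.insert_sdiff_insert, Finset.sdiff_insert_of_notMem (hnot [])]
  have hgauge : gauge q (S a) (markedTerm q ξ S lam C O) =
      ∑ B ∈ O, markedTerm q ξ S lam (insert (a :: B) (C.erase B))
        (insert (a :: B) (O.erase B)) := by
    rw [markedTerm, map_smul, gauge_sortedTensor, Finset.smul_sum]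
    refine Finset.sum_congr rfl fun B hB => ?_
    have hsd : insert (a :: B) (C.erase B) \ insert (a :: B) (O.erase B) = C \ O := by
      rw [Finset.insert_sdiff_insert,
        Finset.sdiff_insert_of_notMem (fun h => hnot B (Finset.mem_of_mem_erase h))]
      ext l
      simp only [Finset.mem_sdiff, Finset.mem_erase]
      grind
    rw [markedTerm, h.markedCrossings_insert_cons_insert ha hO hB, hsd,
      sortedTensor_insert _ (fun l hl => hlt B l (Finset.mem_of_mem_erase hl)),
      chainVector_cons _ _ _ (h.ne_nil B (hO hB)), smul_smul]
    congr 1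
    ring
  have hann : annihilation q (ξ a) (markedTerm q ξ S lam C O) =
      ∑ B ∈ O, markedTerm q ξ S lam (insert (a :: B) (C.erase B)) (O.erase B) := by
    rw [markedTerm, map_smul, annihilation_sortedTensor, Finset.smul_sum]
    refine Finset.sum_congr rfl fun B hB => ?_
    have hsd : insert (a :: B) (C.erase B) \ (O.erase B) = insert (a :: B) (C \ O) := by
      rw [Finset.insert_sdiff_of_notMem _ fun h => hnot B (hO (Finset.mem_of_mem_erase h))]
      congr 1
      ext l
      simp only [Finset.mem_sdiff, Finset.mem_erase]
      grind
    rw [markedTerm, h.markedCrossings_insert_cons ha hO hB, hsd,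
      Finset.prod_insert (fun h => hnot B (Finset.mem_sdiff.1 h).1),
      blockWeight_cons _ _ _ _ (h.ne_nil B (hO hB)), smul_smul]
    congr 1
    ring
  rw [fieldOperator, LinearMap.add_apply, LinearMap.add_apply, LinearMap.add_apply,
    LinearMap.smul_apply, Module.End.one_apply, hann, hgauge, ← hopen, ← hclosed,
    Finset.sum_add_distrib]
  abel

theorem prod_fieldOperator_vacuum (q : ℝ) (ξ : ι → E) (S : ι → E →ₗ[ℂ] E) (lam : ι → ℂ)
    {s : List ι} (hs : s.Pairwise (· < ·)) :
    (s.map fun i => fieldOperator q (ξ i) (S i) (lam i)).prod (vacuum E) =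
      ∑ C ∈ listPartitions s, ∑ O ∈ C.powerset, markedTerm q ξ S lam C O := by
  induction s with
  | nil =>
    simp [listPartitions, markedTerm, sortedTensor, elemList_nil, markedCrossings, crossingCount,
      FamilyArc]
  | cons a s ih =>
    obtain ⟨ha, hs'⟩ := List.pairwise_cons.1 hs
    rw [List.map_cons, List.prod_cons, Module.End.mul_apply, ih hs', map_sum,
      sum_marked_listPartitions_cons hs]
    refine Finset.sum_congr rfl fun C hC => ?_
    rw [map_sum]
    exact Finset.sum_congr rfl fun O hO => fieldOperator_markedTerm q ξ S lam ha
      ((mem_listPartitions hs').1 hC) (Finset.mem_powerset.1 hO)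

theorem vacuumState_prod_fieldOperator (q : ℝ) (ξ : ι → E) (S : ι → E →ₗ[ℂ] E) (lam : ι → ℂ)
    {s : List ι} (hs : s.Pairwise (· < ·)) :
    vacuumState q (s.map fun i => fieldOperator q (ξ i) (S i) (lam i)).prod =
      ∑ C ∈ listPartitions s,
        (q : ℂ) ^ markedCrossings C ∅ * ∏ B ∈ C, blockWeight ξ S lam B := by
  rw [vacuumState, prod_fieldOperator_vacuum q ξ S lam hs, map_sum]
  refine Finset.sum_congr rfl fun C _ => ?_
  -- A remaining open block leaves a tensor of positive degree, orthogonal to the vacuum.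
  rw [map_sum, Finset.sum_eq_single ∅]
  · simp [markedTerm, qInner_vacuum_sortedTensor]
  · intro O _ hO
    simp [markedTerm, qInner_vacuum_sortedTensor, hO]
  · simp

end Moments

/-! ### Translation to set partitions and reduced crossings -/

section SetPartitions

theorem pair_infix_iff {ι : Type*} [LinearOrder ι] {l : List ι} (hl : l.Pairwise (· < ·))
    {i j : ι} :
    [i, j] <:+: l ↔ i ∈ l ∧ j ∈ l ∧ i < j ∧ ∀ k ∈ l, i < k → ¬ k < j := by
  induction l with
  | nil => simp
  | cons x l ih =>
    obtain ⟨hx, hl⟩ := List.pairwise_cons.1 hl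
    obtain _ | ⟨y, l⟩ := l
    · simp only [List.infix_cons_iff, List.mem_singleton]
      simp only [List.cons_prefix_cons, List.prefix_nil, List.infix_nil]
      simp only [reduceCtorEq, and_false, or_self, false_iff]
      rintro ⟨rfl, rfl, h, -⟩
      exact lt_irrefl _ h
    · rw [pair_infix_cons_cons, ih hl]
      obtain ⟨hy, -⟩ := List.pairwise_cons.1 hl
      constructor
      · rintro (⟨hi, hj, hij, h⟩ | ⟨rfl, rfl⟩)
        · refine ⟨List.mem_cons_of_mem _ hi, List.mem_cons_of_mem _ hj, hij, fun k hk hik => ?_⟩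
          rcases List.mem_cons.1 hk with rfl | hk
          · exact absurd hik (hx i hi).asymm
          · exact h k hk hik
        · refine ⟨by simp, by simp, hx _ (by simp), fun k hk hik => ?_⟩
          rcases List.mem_cons.1 hk with rfl | hk
          · exact absurd hik (lt_irrefl _)
          · rcases List.mem_cons.1 hk with rfl | hk
            · exact lt_irrefl _
            · exact (hy k hk).asymm
      · rintro ⟨hi, hj, hij, h⟩
        have hj' : j ∈ y :: l := by
          rcases List.mem_cons.1 hj with rfl | hj
          · rcases List.mem_cons.1 hi with rfl | hi
            · exact absurd hij (lt_irrefl _)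
            · exact absurd hij (hx i hi).asymm
          · exact hj
        rcases List.mem_cons.1 hi with rfl | hi
        · refine Or.inr ⟨rfl, ?_⟩
          rcases List.mem_cons.1 hj' with rfl | hj'
          · rfl
          · exact absurd (hy j hj') (h y (by simp) (hx y (by simp)))
        · exact Or.inl ⟨hi, hj', hij, fun k hk => h k (List.mem_cons_of_mem _ hk)⟩

variable {n : ℕ}

/-- The blocks of a set partition as increasing lists. -/
def partLists (π : SetPartition n) : Finset (List (Fin n)) := π.parts.image fun B => B.sort

theorem sort_injective {α : Type*} [LinearOrder α] :
    Function.Injective fun B : Finset α => B.sort := fun B B' h => by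
  rw [← Finset.sort_toFinset B (· ≤ ·), ← Finset.sort_toFinset B' (· ≤ ·)]
  exact congrArg List.toFinset h

theorem isListPartition_partLists (π : SetPartition n) :
    IsListPartition (List.finRange n) (partLists π) := by
  constructor
  · intro l hl
    obtain ⟨B, hB, rfl⟩ := Finset.mem_image.1 hl
    rw [← List.length_pos_iff, Finset.length_sort, Finset.card_pos]
    exact π.nonempty_of_mem_parts hB
  · intro l hl
    obtain ⟨B, hB, rfl⟩ := Finset.mem_image.1 hl
    exact B.sortedLT_sort.pairwise
  · exact fun _ _ x _ => List.mem_finRange x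
  · intro x _
    obtain ⟨B, hB, hx⟩ := π.exists_mem (Finset.mem_univ x)
    exact ⟨_, Finset.mem_image_of_mem _ hB, (Finset.mem_sort _).2 hx⟩
  · intro l hl l' hl' x hx hx'
    obtain ⟨B, hB, rfl⟩ := Finset.mem_image.1 hl
    obtain ⟨B', hB', rfl⟩ := Finset.mem_image.1 hl'
    rw [Finset.mem_sort] at hx hx'
    rw [π.eq_of_mem_parts hB hB' hx hx']

theorem partLists_injective : Function.Injective (partLists (n := n)) := fun _ _ h =>
  Finpartition.ext (Finset.image_injective sort_injective h)

theorem exists_partLists_eq {C : Finset (List (Fin n))}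
    (h : IsListPartition (List.finRange n) C) : ∃ π : SetPartition n, partLists π = C := by
  have hsort : ∀ l ∈ C, l.toFinset.sort = l := fun l hl =>
    (List.toFinset_sort _ ((h.sorted l hl).imp ne_of_lt)).2 ((h.sorted l hl).imp le_of_lt)
  refine ⟨Finpartition.ofExistsUnique (C.image List.toFinset) (fun _ _ => Finset.subset_univ _)
    ?_ ?_, ?_⟩
  · intro x _
    obtain ⟨l, hl, hx⟩ := h.cover x (List.mem_finRange x)
    refine ⟨l.toFinset, ⟨Finset.mem_image_of_mem _ hl, List.mem_toFinset.2 hx⟩, ?_⟩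
    rintro B ⟨hB, hxB⟩
    obtain ⟨l', hl', rfl⟩ := Finset.mem_image.1 hB
    rw [h.unique l' hl' l hl x (List.mem_toFinset.1 hxB) hx]
  · intro hmem
    obtain ⟨l, hl, hl0⟩ := Finset.mem_image.1 hmem
    exact h.ne_nil l hl ((List.toFinset_eq_empty_iff l).1 hl0)
  · rw [partLists, Finpartition.ofExistsUnique_parts, Finset.image_image]
    conv_rhs => rw [← Finset.image_id (s := C)]
    exact Finset.image_congr fun l hl => hsort l hl

theorem sum_listPartitions_finRange {M : Type*} [AddCommMonoid M]
    (f : Finset (List (Fin n)) → M) :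
    ∑ C ∈ listPartitions (List.finRange n), f C = ∑ π : SetPartition n, f (partLists π) := by
  have hs : (List.finRange n).Pairwise (· < ·) := (List.sortedLT_finRange n).pairwise
  symm
  refine Finset.sum_bij (fun π _ => partLists π)
    (fun π _ => (mem_listPartitions hs).2 (isListPartition_partLists π))
    (fun _ _ _ _ h => partLists_injective h) (fun C hC => ?_) fun _ _ => rfl
  obtain ⟨π, h⟩ := exists_partLists_eq ((mem_listPartitions hs).1 hC)
  exact ⟨π, Finset.mem_univ _, h⟩

theorem familyArc_partLists (π : SetPartition n) (i j : Fin n) :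
    FamilyArc (partLists π) i j ↔ IsArc π i j := by
  constructor
  · rintro ⟨l, hl, h⟩
    obtain ⟨B, hB, rfl⟩ := Finset.mem_image.1 hl
    rw [pair_infix_iff B.sortedLT_sort.pairwise] at h
    simp only [Finset.mem_sort] at h
    obtain ⟨hi, hj, hij, h⟩ := h
    have hiB := π.part_eq_of_mem hB hi
    refine ⟨hij, hiB.trans (π.part_eq_of_mem hB hj).symm, fun k hik hkj hk => h k ?_ hik hkj⟩
    rw [← hiB, ← hk]
    exact π.mem_part (Finset.mem_univ k)
  · rintro ⟨hij, hpart, h⟩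
    refine ⟨_, Finset.mem_image_of_mem _ (π.part_mem.2 (Finset.mem_univ i)), ?_⟩
    rw [pair_infix_iff (Finset.sortedLT_sort _).pairwise]
    simp only [Finset.mem_sort]
    refine ⟨π.mem_part (Finset.mem_univ i), hpart ▸ π.mem_part (Finset.mem_univ j), hij,
      fun k hk hik hkj => h k hik hkj ?_⟩
    exact π.part_eq_of_mem (π.part_mem.2 (Finset.mem_univ i)) hk

theorem IsArc.left_unique {π : SetPartition n} {s s' t : Fin n} (h : IsArc π s t)
    (h' : IsArc π s' t) : s = s' := by
  rcases lt_trichotomy s s' with hlt | heq | hlt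
  · exact absurd (h'.2.1.trans h.2.1.symm) (h.2.2 s' hlt h'.1)
  · exact heq
  · exact absurd (h.2.1.trans h'.2.1.symm) (h'.2.2 s hlt h.1)

/-- Without marks, a counted triple `(i, j, t)` needs an arc ending at `t` that starts before `i`;
its left end is determined by `t`, so triples correspond to crossing pairs of arcs. -/
theorem markedCrossings_partLists (π : SetPartition n) :
    markedCrossings (partLists π) ∅ = reducedCrossings π := by
  classical
  rw [markedCrossings, crossingCount, reducedCrossings]
  symm
  refine Finset.card_bij (fun p _ => (p.2.1, p.2.2, p.1.2)) ?_ ?_ ?_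
  · rintro ⟨⟨s, t⟩, i, j⟩ h
    simp only [Finset.mem_filter, Finset.mem_univ, true_and, familyArc_partLists] at h ⊢
    exact ⟨h.2.1, h.2.2.2.1, h.2.2.2.2, Or.inr ⟨s, h.2.2.1, h.1⟩⟩
  · rintro ⟨⟨s, t⟩, i, j⟩ h ⟨⟨s', t'⟩, i', j'⟩ h' heq
    simp only [Finset.mem_filter, Finset.mem_univ, true_and, Prod.mk.injEq] at h h' heq ⊢
    obtain ⟨rfl, rfl, rfl⟩ := heq
    exact ⟨⟨h.1.left_unique h'.1, rfl⟩, rfl, rfl⟩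
  · rintro ⟨i, j, t⟩ h
    simp only [Finset.mem_filter, Finset.mem_univ, true_and, familyArc_partLists] at h
    obtain ⟨hij, hit, htj, ⟨l, hl, -⟩ | ⟨s, hsi, hst⟩⟩ := h
    · exact absurd hl (Finset.notMem_empty l)
    · exact ⟨((s, t), (i, j)), by simp [hij, hst, hsi, hit, htj], rfl⟩

theorem vacuumState_prod_ofFn {E : Type*} [NormedAddCommGroup E] [InnerProductSpace ℂ E] (q : ℝ)
    (ξ : Fin n → E) (S : Fin n → E →ₗ[ℂ] E) (lam : Fin n → ℂ) :
    vacuumState q (List.ofFn fun i => fieldOperator q (ξ i) (S i) (lam i)).prod =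
      ∑ π : SetPartition n,
        (q : ℂ) ^ reducedCrossings π * ∏ B ∈ π.parts, blockWeight ξ S lam B.sort := by
  rw [List.ofFn_eq_map, vacuumState_prod_fieldOperator q ξ S lam
    (List.sortedLT_finRange n).pairwise, sum_listPartitions_finRange]
  refine Finset.sum_congr rfl fun π _ => ?_
  rw [markedCrossings_partLists, partLists, Finset.prod_image fun _ _ _ _ h => sort_injective h]

theorem le_iff_label (π σ : SetPartition n) :
    π ≤ σ ↔ ∀ B ∈ π.parts, ∀ i ∈ B, ∀ j ∈ B, label σ i = label σ j := by
  constructor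
  · intro h B hB i hi j hj
    obtain ⟨B', hB', hle⟩ := h hB
    rw [label_eq_iff, σ.part_eq_of_mem hB' (hle hi), σ.part_eq_of_mem hB' (hle hj)]
  · intro h B hB
    obtain ⟨i, hi⟩ := π.nonempty_of_mem_parts hB
    refine ⟨σ.part i, σ.part_mem.2 (Finset.mem_univ i), fun j hj => ?_⟩
    rw [(label_eq_iff σ i j).1 (h B hB i hi j hj)]
    exact σ.mem_part (Finset.mem_univ j)

/-- Positivity matters: for `n = 0` the top partition has no blocks. -/
theorem parts_top {n : ℕ} (hn : 0 < n) : (⊤ : SetPartition n).parts = {Finset.univ} := by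
  refine Finset.Nonempty.subset_singleton_iff ?_ |>.1 (Finpartition.parts_top_subset _)
  exact ⟨_, Finpartition.part_mem _ |>.2 (Finset.mem_univ (⟨0, hn⟩ : Fin n))⟩

theorem reducedCrossings_top : reducedCrossings (⊤ : SetPartition n) = 0 := by
  have hpart : ∀ i : Fin n, (⊤ : SetPartition n).part i = Finset.univ := fun i =>
    Finset.mem_singleton.1 (Finpartition.parts_top_subset _
      (Finpartition.part_mem _ |>.2 (Finset.mem_univ i)))
  classical
  rw [reducedCrossings, Finset.card_eq_zero, Finset.filter_eq_empty_iff]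
  rintro ⟨⟨s, t⟩, i, j⟩ - ⟨h, -, hsi, hit, -⟩
  exact h.2.2 i hsi hit (by rw [hpart, hpart])

end SetPartitions

/-! ### Coloured copies, Möbius inversion and identification of the cumulants -/

section Coloring

variable {V : Type*} [NormedAddCommGroup V] [InnerProductSpace ℂ V] {D : Submodule ℂ V}
variable {ι : Type*}

theorem basisTensor_zero (j : ℕ) : basisTensor j (0 : D) = 0 := by
  simpa using basisTensor_smul j (0 : ℂ) (0 : D)

theorem projTensor_basisTensor (j k : ℕ) (T : D →ₗ[ℂ] D) (v : D) :
    projTensor j T (basisTensor k v) = if k = j then basisTensor j (T v) else 0 := by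
  split_ifs with h
  · subst h
    refine congrArg (fun w => basisTensor k (T w)) (Subtype.ext ?_)
    exact lp.single_apply_self (E := fun _ : ℕ => V) 2 k (v : V)
  · refine (congrArg (fun w => basisTensor j (T w)) (Subtype.ext ?_)).trans
      ((congrArg _ (map_zero T)).trans (basisTensor_zero j))
    exact lp.single_apply_ne (E := fun _ : ℕ => V) 2 k (v : V) (Ne.symm h)

theorem inner_basisTensor (j k : ℕ) (v w : D) :
    inner ℂ (basisTensor j v) (basisTensor k w) = if k = j then inner ℂ v w else 0 := by
  have h : inner ℂ (basisTensor j v) (basisTensor k w) =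
      inner ℂ (v : V) ((lp.single 2 k (w : V) : EllTwo V) j) :=
    lp.inner_single_left (𝕜 := ℂ) (G := fun _ : ℕ => V) j (v : V) (lp.single 2 k (w : V))
  rw [h]
  split_ifs with hkj
  · subst hkj
    exact congrArg (inner ℂ (v : V)) (lp.single_apply_self (E := fun _ : ℕ => V) 2 k (w : V))
  · exact (congrArg (inner ℂ (v : V))
      (lp.single_apply_ne (E := fun _ : ℕ => V) 2 k (w : V) (Ne.symm hkj))).trans
      (inner_zero_right _)

/-- Each `P_j` in the chain kills a vector of another colour, so a chain survives only if it is
monochromatic. -/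
theorem chainVector_basisTensor (c : ι → ℕ) (v : ι → D) (T : ι → D →ₗ[ℂ] D) (i : ι) (l : List ι)
    [Decidable (∀ x ∈ l, c x = c i)] :
    chainVector (fun i => basisTensor (c i) (v i)) (fun i => projTensor (c i) (T i)) (i :: l) =
      if ∀ x ∈ l, c x = c i then basisTensor (c i) (chainVector v T (i :: l)) else 0 := by
  classical
  induction l generalizing i with
  | nil => simp [chainVector]
  | cons k l ih =>
    rw [chainVector_cons _ _ _ (List.cons_ne_nil k l), ih,
      chainVector_cons _ _ _ (List.cons_ne_nil k l)]
    by_cases hk : ∀ x ∈ l, c x = c k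
    · rw [if_pos hk, projTensor_basisTensor]
      refine if_congr ?_ rfl rfl
      simp only [List.forall_mem_cons]
      exact ⟨fun h => ⟨h, fun x hx => (hk x hx).trans h⟩, And.left⟩
    · rw [if_neg hk, map_zero, if_neg]
      intro h
      rw [List.forall_mem_cons] at h
      exact hk fun x hx => (h.2 x hx).trans h.1.symm

theorem blockWeight_basisTensor (c : ι → ℕ) (v : ι → D) (T : ι → D →ₗ[ℂ] D) (lam : ι → ℂ)
    (l : List ι) [Decidable (∀ i ∈ l, ∀ j ∈ l, c i = c j)] :
    blockWeight (fun i => basisTensor (c i) (v i)) (fun i => projTensor (c i) (T i)) lam l =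
      if ∀ i ∈ l, ∀ j ∈ l, c i = c j then blockWeight v T lam l else 0 := by
  classical
  obtain _ | ⟨i, _ | ⟨k, l⟩⟩ := l
  · simp [blockWeight]
  · simp [blockWeight]
  · rw [blockWeight_cons _ _ _ _ (List.cons_ne_nil k l), chainVector_basisTensor,
      blockWeight_cons _ _ _ _ (List.cons_ne_nil k l)]
    have key : (∀ x ∈ i :: k :: l, ∀ y ∈ i :: k :: l, c x = c y) ↔
        (∀ x ∈ l, c x = c k) ∧ c k = c i := by
      constructor
      · exact fun h => ⟨fun x hx => h x (by simp [hx]) k (by simp), h k (by simp) i (by simp)⟩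
      · rintro ⟨h, hki⟩
        have : ∀ x ∈ i :: k :: l, c x = c k := by
          simp only [List.forall_mem_cons]
          exact ⟨hki.symm, trivial, h⟩
        exact fun x hx y hy => (this x hx).trans (this y hy).symm
    by_cases hk : ∀ x ∈ l, c x = c k
    · rw [if_pos hk, inner_basisTensor]
      refine if_congr ?_ rfl rfl
      rw [key]
      exact ⟨fun h => ⟨hk, h⟩, And.right⟩
    · rw [if_neg hk, inner_zero_right, if_neg fun h => hk (key.1 h).1]

theorem blockWeight_map {κ E : Type*} [NormedAddCommGroup E] [InnerProductSpace ℂ E] (e : κ → ι)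
    (ξ : ι → E) (S : ι → E →ₗ[ℂ] E) (lam : ι → ℂ) (l : List κ) :
    blockWeight (fun k => ξ (e k)) (fun k => S (e k)) (fun k => lam (e k)) l =
      blockWeight ξ S lam (l.map e) := by
  have hchain : ∀ l : List κ, chainVector (fun k => ξ (e k)) (fun k => S (e k)) l =
      chainVector ξ S (l.map e) := by
    intro l
    induction l with
    | nil => rfl
    | cons i l ih =>
      obtain _ | ⟨k, l⟩ := l
      · rfl
      · rw [chainVector_cons _ _ _ (List.cons_ne_nil k l), ih]
        rfl
  obtain _ | ⟨i, _ | ⟨k, l⟩⟩ := l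
  · rfl
  · rfl
  · rw [blockWeight_cons _ _ _ _ (List.cons_ne_nil k l), hchain]
    rfl

variable {n : ℕ}

/-- The weight `q^{rc(π)} ∏_B K(B)` of a set partition, which is the value of the partitioned
cumulant (see `partCumulant_gaugeProcess`). -/
def cumulantValue (q : ℝ) (v : Fin n → D) (T : Fin n → D →ₗ[ℂ] D) (lam : Fin n → ℂ)
    (π : SetPartition n) : ℂ :=
  (q : ℂ) ^ reducedCrossings π * ∏ B ∈ π.parts, blockWeight v T lam B.sort

open Classical in
-- The colours are the labels of `σ`, so the partitions with monochromatic blocks are exactly those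
-- below `σ`; `q^rc` does not see the colours.
theorem partMoment_gaugeProcess (q : ℝ) (v : Fin n → D) (T : Fin n → D →ₗ[ℂ] D)
    (lam : Fin n → ℂ) (σ : SetPartition n) :
    partMoment (vacuumState q) (fun i k => gaugeProcess q k (v i) (T i) (lam i)) σ =
      ∑ π ∈ Finset.univ.filter (fun π : SetPartition n => π ≤ σ), cumulantValue q v T lam π := by
  refine (vacuumState_prod_ofFn q (fun i => basisTensor (label σ i) (v i))
    (fun i => projTensor (label σ i) (T i)) lam).trans ?_
  rw [Finset.sum_filter]
  refine Finset.sum_congr rfl fun π _ => ?_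
  have hw : ∀ B : Finset (Fin n), blockWeight (fun i => basisTensor (label σ i) (v i))
      (fun i => projTensor (label σ i) (T i)) lam B.sort =
      if ∀ i ∈ B, ∀ j ∈ B, label σ i = label σ j then blockWeight v T lam B.sort else 0 := by
    intro B
    rw [blockWeight_basisTensor]
    simp only [Finset.mem_sort]
  simp only [hw]
  split_ifs with h
  · rw [le_iff_label] at h
    rw [cumulantValue]
    congr 1
    exact Finset.prod_congr rfl fun B hB => if_pos (h B hB)
  · rw [le_iff_label] at h
    push Not at h
    obtain ⟨B, hB, i, hi, j, hj, hij⟩ := h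
    rw [Finset.prod_eq_zero hB (if_neg fun h => hij (h i hi j hj)), mul_zero]

theorem partCumulant_gaugeProcess (q : ℝ) (v : Fin n → D) (T : Fin n → D →ₗ[ℂ] D)
    (lam : Fin n → ℂ) (π : SetPartition n) :
    partCumulant (vacuumState q) (fun i k => gaugeProcess q k (v i) (T i) (lam i)) π =
      cumulantValue q v T lam π := by
  classical
  let _ : LocallyFiniteOrder (SetPartition n) := Fintype.toLocallyFiniteOrder
  have hIic : ∀ σ : SetPartition n,
      Finset.univ.filter (fun π : SetPartition n => π ≤ σ) = Finset.Iic σ := by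
    intro σ
    ext π
    simp
  have h := IncidenceAlgebra.moebius_inversion_bot (𝕜 := ℂ) (cumulantValue q v T lam)
    (partMoment (vacuumState q) fun i k => gaugeProcess q k (v i) (T i) (lam i))
    (fun σ => by
      rw [partMoment_gaugeProcess, ← hIic]) π
  rw [h, partCumulant, ← hIic]
  refine Finset.sum_congr (by congr!) fun σ _ => ?_
  rw [mul_comm, moebius]

/-- The formula for partitioned cumulants, applied to the variables of `B` alone and the top
partition, has no crossings and a single block, which reads the indices of `B` in increasing order.
-/
theorem cumulant_gaugeProcess (q : ℝ) (v : Fin n → D) (T : Fin n → D →ₗ[ℂ] D) (lam : Fin n → ℂ)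
    {B : Finset (Fin n)} (hB : B.Nonempty) :
    cumulant (vacuumState q) (fun (i : Fin B.card) k =>
      gaugeProcess q k (v (B.orderEmbOfFin rfl i)) (T (B.orderEmbOfFin rfl i))
        (lam (B.orderEmbOfFin rfl i))) = blockWeight v T lam B.sort := by
  refine (partCumulant_gaugeProcess q (fun i : Fin B.card => v (B.orderEmbOfFin rfl i))
    (fun i => T (B.orderEmbOfFin rfl i)) (fun i => lam (B.orderEmbOfFin rfl i)) ⊤).trans ?_
  rw [cumulantValue, reducedCrossings_top, pow_zero, one_mul, parts_top (Finset.card_pos.2 hB),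
    Finset.prod_singleton, blockWeight_map (B.orderEmbOfFin rfl) v T lam, Fin.sort_univ]
  congr 1
  refine List.SortedLT.eq_of_mem_iff ?_ B.sortedLT_sort fun x => ?_
  · exact ((List.sortedLT_finRange _).pairwise.map _
      fun _ _ h => (B.orderEmbOfFin rfl).lt_iff_lt.2 h).sortedLT
  · rw [Finset.mem_sort, ← Finset.mem_coe, ← Finset.range_orderEmbOfFin B rfl]
    simp

end Coloring

end QFock

end

theorem mainTheorem7 {V : Type*} [NormedAddCommGroup V] [InnerProductSpace ℂ V] [CompleteSpace V]
    (D : Submodule ℂ V) (hD : Dense (D : Set V)) (q : ℝ) (n : ℕ)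
    (v : Fin n → D) (T : Fin n → D →ₗ[ℂ] D) (lam : Fin n → ℂ) (π : QFock.SetPartition n) :
    QFock.partCumulant (QFock.vacuumState q)
        (fun i k => QFock.gaugeProcess q k (v i) (T i) (lam i)) π =
      (q : ℂ) ^ QFock.reducedCrossings π *
        ∏ B ∈ π.parts,
          QFock.cumulant (QFock.vacuumState q)
            (fun (i : Fin B.card) k =>
              QFock.gaugeProcess q k (v (B.orderEmbOfFin rfl i)) (T (B.orderEmbOfFin rfl i))
                (lam (B.orderEmbOfFin rfl i))) := by
  rw [QFock.partCumulant_gaugeProcess, QFock.cumulantValue]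
  congr 1
  exact Finset.prod_congr rfl fun B hB =>
    (QFock.cumulant_gaugeProcess q v T lam (π.nonempty_of_mem_parts hB)).symm
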